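/- Let $S_j(x)=r_jx+d_j$ $(0\le j<m)$ be finitely many contractions of $\mathbb R$ with $0<r_j<1$, let $p_j>0$ with $\sum_j p_j=1$, and let $\mu$ be the associated self-similar measure, i.e. the Borel probability measure on $\mathbb R$ with $\mu(E)=\sum_j p_j\,\mu(S_j^{-1}(E))$ for all Borel sets $E$. Put $\lambda=\min_j r_j$, and for a finite word $v=v_1\cdots v_n$ put $S_v=S_{v_1}\circ\cdots\circ S_{v_n}$ and $r_v=r_{v_1}\cdots r_{v_n}$; for $n\ge 1$ put $v^-=v_1\cdots v_{n-1}$. Assume that $\operatorname{supp}\mu=[0,1]$ and that the weak separation condition holds: the number of distinct maps in $$\{S_v : r_v\le r<r_{v^-},\ x\in S_v([0,1])\}$$ is bounded uniformly in $x\in[0,1]$ and $r\in(0,1)$. Let $B(x,r)$ denote the closed ball. For $\delta>0$ let $H(\delta)\in[0,\infty]$ be the infimum of all $s\in\mathbb R$ for which there are $C_1,C_2>0$ such that $\mu(B(x,R))/\mu(B(x,r))\le C_2(R/r)^s$ for all $x\in\operatorname{supp}\mu$ and all $r,R$ with $0<r\le R^{1+\delta}\le R\le C_1$ (and $H(\delta)=\infty$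 if there is no such $s$). Let $\dim_{qA}\mu=\lim_{\delta\to0^+}H(\delta)$ be the quasi-Assouad dimension of $\mu$. Then: 1. $\dim_{qA}\mu<\infty$ if and only if for all $q>1$ and $0<A<B$ there is a constant $c=c(q,A,B)>0$ such that $$\mu(B(x,A\lambda^n))\ge c\,q^{-n}\mu(B(x,B\lambda^n))\qquad\text{for all } n\in\mathbb N \text{ and } x\in\operatorname{supp}\mu .$$ 2. Equivalently, $\dim_{qA}\mu<\infty$ if and only if for every $\varepsilon>0$ there is a constant $C>0$ such that $$\mu(B(x,r))\ge C\,r^{\varepsilon}\mu(B(x,2r))\qquad\text{for all } 0<r<1 \text{ and } x\in\operatorname{supp}\mu .$$ -/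

import Mathlib

open MeasureTheory Set

/-- A weighted iterated function system on the real line: the contractions
`S j x = ratio j * x + shift j` for `j < m`, with positive contraction ratios and a
non-degenerate probability vector `prob`. -/
structure WeightedIFS (m : ℕ) where
  ratio : Fin m → ℝ
  shift : Fin m → ℝ
  prob : Fin m → ℝ
  ratio_pos : ∀ j, 0 < ratio j
  ratio_lt_one : ∀ j, ratio j < 1
  prob_pos : ∀ j, 0 < prob j
  prob_sum : ∑ j, prob j = 1

namespace WeightedIFS

variable {m : ℕ} (F : WeightedIFS m)

/-- The contraction `S j`. -/
def toFun (j : Fin m) (x : ℝ) : ℝ := F.ratio j * x + F.shift j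

/-- The minimal contraction factor `λ = min_j r_j`. (The index set is finite, and it is
non-empty because the probabilities add up to one.) -/
noncomputable def minRatio : ℝ := ⨅ j, F.ratio j

/-- `S_w = S_{w₁} ∘ S_{w₂} ∘ ⋯ ∘ S_{wₙ}` for a finite word `w = w₁w₂⋯wₙ`. -/
def wordMap : List (Fin m) → ℝ → ℝ
  | [] => id
  | j :: w => F.toFun j ∘ wordMap w

/-- `r_w = r_{w₁} r_{w₂} ⋯ r_{wₙ}`, which is the length of the interval `S_w([0,1])`. -/
def wordRatio (w : List (Fin m)) : ℝ := (w.map F.ratio).prod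

/-- The set `{S_v : |S_v([0,1])| ≤ r < |S_{v⁻}([0,1])|, x ∈ S_v([0,1])}` of maps, where `v⁻` is
`v` without its last letter. Words that give the same map are counted once. -/
def mapsAt (x r : ℝ) : Set (ℝ → ℝ) :=
  {T | ∃ v : List (Fin m), F.wordRatio v ≤ r ∧ r < F.wordRatio v.dropLast ∧
    x ∈ F.wordMap v '' Icc 0 1 ∧ T = F.wordMap v}

/-- The weak separation condition: the cardinality of `mapsAt x r` is bounded uniformly in
`x ∈ [0,1]` and `r ∈ (0,1)`. -/
def WeakSeparation : Prop :=
  ∃ K : ℕ, ∀ r ∈ Ioo (0 : ℝ) 1, ∀ x ∈ Icc (0 : ℝ) 1, (F.mapsAt x r).encard ≤ K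

/-- `μ` is the self-similar measure of the weighted system: the Borel probability measure with
`μ(E) = ∑ j, p_j μ(S_j⁻¹(E))` for all Borel sets `E`. -/
def IsSelfSimilarMeasure (μ : Measure ℝ) : Prop :=
  IsProbabilityMeasure μ ∧ ∀ E : Set ℝ, MeasurableSet E →
    μ E = ∑ j, ENNReal.ofReal (F.prob j) * μ (F.toFun j ⁻¹' E)

end WeightedIFS

/-- The exponents `s` that are admissible in the definition of `H(δ)`: there are `C₁, C₂ > 0` with
`μ(B(x,R)) / μ(B(x,r)) ≤ C₂ (R/r)^s` for all `0 < r ≤ R^(1+δ) ≤ R ≤ C₁` and `x ∈ supp μ`. -/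
def quasiAssouadExponents (μ : Measure ℝ) (δ : ℝ) : Set ℝ :=
  {s | ∃ C₁ > 0, ∃ C₂ > 0, ∀ r R : ℝ, 0 < r → r ≤ R ^ (1 + δ) → R ^ (1 + δ) ≤ R → R ≤ C₁ →
    ∀ x ∈ μ.support,
      μ.real (Metric.closedBall x R) / μ.real (Metric.closedBall x r) ≤ C₂ * (R / r) ^ s}

/-- `H(δ)`, the infimum of the admissible exponents (`⊤` if there are none). -/
noncomputable def quasiAssouadH (μ : Measure ℝ) (δ : ℝ) : EReal :=
  sInf ((fun s : ℝ => (s : EReal)) '' quasiAssouadExponents μ δ)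

/-- The quasi-Assouad dimension `lim_{δ → 0+} H(δ)`. As `H` decreases when `δ > 0` grows, the limit
is the supremum over `δ > 0`; see `tendsto_quasiAssouadH`. -/
noncomputable def quasiAssouadDim (μ : Measure ℝ) : EReal :=
  ⨆ δ : Ioi (0 : ℝ), quasiAssouadH μ δ

theorem quasiAssouadH_antitoneOn (μ : Measure ℝ) : AntitoneOn (quasiAssouadH μ) (Ioi 0) := by
  intro δ hδ δ' hδ' h
  refine sInf_le_sInf (image_mono ?_)
  rintro s ⟨C₁, h₁, C₂, h₂, H⟩
  refine ⟨C₁, h₁, C₂, h₂, fun r R hr hrR hRR hRC => ?_⟩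
  simp only [mem_Ioi] at hδ hδ'
  have hR : 0 < R := by linarith
  have hR1 : R ≤ 1 := by
    by_contra! hc
    have := Real.rpow_lt_rpow_of_exponent_lt hc (show (1 : ℝ) < 1 + δ' by linarith)
    rw [Real.rpow_one] at this
    linarith
  refine H r R hr (hrR.trans ?_) ?_ hRC
  · exact Real.rpow_le_rpow_of_exponent_ge hR hR1 (by linarith)
  · simpa using Real.rpow_le_rpow_of_exponent_ge hR hR1 (show (1 : ℝ) ≤ 1 + δ by linarith)

theorem tendsto_quasiAssouadH (μ : Measure ℝ) :
    Filter.Tendsto (quasiAssouadH μ) (nhdsWithin 0 (Ioi 0)) (nhds (quasiAssouadDim μ)) := by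
  have h := (quasiAssouadH_antitoneOn μ).tendsto_nhdsGT (OrderTop.bddAbove _)
  rwa [sSup_image'] at h

/-! Both conditions are forms of `QuasiDoubling`, so the point is its equivalence with finite
dimension. If the dimension is finite, compare the radii r and R = r^(1/(1+δ)): for small r, R
exceeds 2r, and for δ small the factor (R/r)^s is at most r^(-ε).

For the converse, weak separation provides, next to any x, a ball B(z, κR) that meets only those
level-R intervals S_v([0,1]) which contain x (`WeakSeparation.exists_ball`). Each of these puts at
least a fraction c(r/R)^s of its mass into B(x, r), because balls in the support have at least a
power of the radius as mass. Hence μ(B(x, r)) ≥ c(r/R)^s μ(B(z, κR)), and quasi-doubling at z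
replaces B(z, κR) by B(x, R) at the cost of R^δ ≥ r/R. So s + 1 is admissible for every δ.

The ball exists because substantially overlapping intervals have only finitely many relative
positions (`WeakSeparation.finite_relPos`), and intervals of comparable length that overlap at all
overlap substantially (`WeakSeparation.exists_le_overlap`). The endpoints therefore cut S_v([0,1])
into gaps of length bounded below in proportion, and z is the middle of a gap whose closure contains
x. -/

/-! ### Finite sets of real numbers and their gaps. -/

theorem Set.Finite.exists_pos_le_of_pos {S : Set ℝ} (hS : S.Finite) :
    ∃ d > 0, ∀ s ∈ S, 0 < s → d ≤ s := by
  induction S, hS using Set.Finite.induction_on with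
  | empty => exact ⟨1, one_pos, by simp⟩
  | @insert a S _ _ ih =>
    obtain ⟨d, hd, h⟩ := ih
    by_cases ha : 0 < a
    · refine ⟨min a d, lt_min ha hd, fun s hs hs0 => ?_⟩
      rcases hs with rfl | hs
      · exact min_le_left _ _
      · exact (min_le_right _ _).trans (h s hs hs0)
    · refine ⟨d, hd, fun s hs hs0 => ?_⟩
      rcases hs with rfl | hs
      · exact absurd hs0 ha
      · exact h s hs hs0

/-- Every point of `[0,1]` lies in the closure of a gap of the finite set `Z`, and all gaps have
length bounded below. -/
theorem Set.Finite.exists_gap {Z : Set ℝ} (hZ : Z.Finite) (h0 : (0 : ℝ) ∈ Z) (h1 : (1 : ℝ) ∈ Z) :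
    ∃ κ > 0, ∀ x ∈ Icc (0 : ℝ) 1, ∃ z ∈ Icc (0 : ℝ) 1, 0 < z - κ ∧ z + κ < 1 ∧
      ∀ a ∈ Z, ∀ b ∈ Z, a ≤ z + κ → z - κ ≤ b → x ∈ Icc a b := by
  obtain ⟨d, hd, hgap⟩ := ((hZ.prod hZ).image fun p : ℝ × ℝ => p.2 - p.1).exists_pos_le_of_pos
  refine ⟨d / 3, by positivity, fun x hx => ?_⟩
  -- The condition 0 < f matters only for x = 0, where it leaves room for a left neighbour of f in
  -- Z.
  obtain ⟨f, ⟨hfZ, hxf, hf0⟩, hfmin⟩ := Set.exists_min_image {f | f ∈ Z ∧ x ≤ f ∧ 0 < f} id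
    (hZ.subset fun f hf => hf.1) ⟨1, h1, hx.2, one_pos⟩
  obtain ⟨e, ⟨heZ, hef⟩, hemax⟩ := Set.exists_max_image {e | e ∈ Z ∧ e < f} id
    (hZ.subset fun f hf => hf.1) ⟨0, h0, hf0⟩
  simp only [id, mem_ofPred_eq, and_imp] at hfmin hemax
  have hex : e ≤ x := by
    by_contra! h
    exact absurd (hfmin e heZ h.le (hx.1.trans_lt h)) (not_le.2 hef)
  have he0 : 0 ≤ e := hemax 0 h0 hf0
  have hf1 : f ≤ 1 := hfmin 1 h1 hx.2 one_pos
  have hde : d ≤ f - e := hgap _ ⟨(e, f), ⟨heZ, hfZ⟩, rfl⟩ (sub_pos.2 hef)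
  refine ⟨(e + f) / 2, ⟨by linarith, by linarith⟩, by linarith, by linarith,
    fun a ha b hb hab hba => ⟨?_, ?_⟩⟩
  · exact (hemax a ha (by linarith)).trans hex
  · by_contra! h
    exact absurd (hemax b hb (by linarith)) (by linarith)

/-! ### Words, their affine maps and levels. -/

namespace WeightedIFS

variable {m : ℕ} (F : WeightedIFS m)

theorem nonempty_fin {m : ℕ} (F : WeightedIFS m) : Nonempty (Fin m) := by
  by_contra h
  rw [not_nonempty_iff] at h
  simpa using F.prob_sum

theorem minRatio_le (j : Fin m) : F.minRatio ≤ F.ratio j :=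
  ciInf_le (Set.finite_range _).bddBelow j

theorem minRatio_pos : 0 < F.minRatio := by
  have := F.nonempty_fin
  obtain ⟨j, hj⟩ := exists_eq_ciInf_of_finite (f := F.ratio)
  exact (F.ratio_pos j).trans_eq hj

theorem minRatio_lt_one : F.minRatio < 1 := by
  have := F.nonempty_fin
  obtain ⟨j⟩ := this
  exact (F.minRatio_le j).trans_lt (F.ratio_lt_one j)

theorem exists_ratio_le : ∃ ρ : ℝ, 0 < ρ ∧ ρ < 1 ∧ ∀ j, F.ratio j ≤ ρ := by
  have := F.nonempty_fin
  obtain ⟨j, hj⟩ := Finite.exists_max F.ratio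
  exact ⟨F.ratio j, F.ratio_pos j, F.ratio_lt_one j, hj⟩

@[simp] theorem wordRatio_nil : F.wordRatio [] = 1 := rfl

@[simp] theorem wordRatio_cons (j : Fin m) (w : List (Fin m)) :
    F.wordRatio (j :: w) = F.ratio j * F.wordRatio w := by simp [wordRatio]

theorem wordRatio_append (u v : List (Fin m)) :
    F.wordRatio (u ++ v) = F.wordRatio u * F.wordRatio v := by simp [wordRatio]

theorem wordRatio_pos (w : List (Fin m)) : 0 < F.wordRatio w := by
  induction w with
  | nil => simp
  | cons j w ih => simpa using mul_pos (F.ratio_pos j) ih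

theorem wordRatio_le_one (w : List (Fin m)) : F.wordRatio w ≤ 1 := by
  induction w with
  | nil => simp
  | cons j w ih =>
    simpa using mul_le_one₀ (F.ratio_lt_one j).le (F.wordRatio_pos w).le ih

theorem wordRatio_concat (w : List (Fin m)) (j : Fin m) :
    F.wordRatio (w ++ [j]) = F.wordRatio w * F.ratio j := by simp [wordRatio_append]

theorem eq_nil_of_one_le_wordRatio {w : List (Fin m)} (h : 1 ≤ F.wordRatio w) : w = [] := by
  cases w with
  | nil => rfl
  | cons j w =>
    rw [wordRatio_cons] at h
    nlinarith [F.ratio_lt_one j, F.ratio_pos j, F.wordRatio_le_one w, F.wordRatio_pos w]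

theorem minRatio_mul_wordRatio_dropLast_le (w : List (Fin m)) :
    F.minRatio * F.wordRatio w.dropLast ≤ F.wordRatio w := by
  rcases List.eq_nil_or_concat' w with rfl | ⟨v, j, rfl⟩
  · simpa using F.minRatio_lt_one.le
  · rw [List.dropLast_concat, wordRatio_concat, mul_comm]
    exact mul_le_mul_of_nonneg_left (F.minRatio_le j) (F.wordRatio_pos v).le

theorem wordRatio_le_pow {ρ : ℝ} (hρ0 : 0 < ρ) (hρ : ∀ j, F.ratio j ≤ ρ) (w : List (Fin m)) :
    F.wordRatio w ≤ ρ ^ w.length := by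
  induction w with
  | nil => simp
  | cons j w ih =>
    rw [wordRatio_cons, List.length_cons, pow_succ']
    exact mul_le_mul (hρ j) ih (F.wordRatio_pos w).le hρ0.le

theorem finite_le_wordRatio {κ : ℝ} (hκ : 0 < κ) : {w | κ ≤ F.wordRatio w}.Finite := by
  obtain ⟨ρ, hρ0, hρ1, hρ⟩ := F.exists_ratio_le
  obtain ⟨n, hn⟩ := exists_pow_lt_of_lt_one hκ hρ1
  refine (List.finite_length_lt (Fin m) n).subset fun w hw => ?_
  by_contra! h
  have h1 := F.wordRatio_le_pow hρ0 hρ w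
  have h2 := pow_le_pow_of_le_one hρ0.le hρ1.le (not_lt.1 h)
  simp only [mem_ofPred_eq] at hw
  linarith

theorem wordMap_append (u v : List (Fin m)) (x : ℝ) :
    F.wordMap (u ++ v) x = F.wordMap u (F.wordMap v x) := by
  induction u with
  | nil => rfl
  | cons j u ih => simp [wordMap, ih]

theorem wordMap_apply (w : List (Fin m)) (x : ℝ) :
    F.wordMap w x = F.wordRatio w * x + F.wordMap w 0 := by
  induction w with
  | nil => simp [wordMap]
  | cons j w ih =>
    simp only [wordMap, Function.comp_apply, toFun, wordRatio_cons]
    rw [ih]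
    ring

theorem wordMap_concat_zero (w : List (Fin m)) (j : Fin m) :
    F.wordMap (w ++ [j]) 0 = F.wordRatio w * F.shift j + F.wordMap w 0 := by
  rw [wordMap_append, wordMap_apply]
  simp [wordMap, toFun]

/-- The interval `S_w([0,1])`. -/
theorem wordMap_image (w : List (Fin m)) :
    F.wordMap w '' Icc 0 1 = Icc (F.wordMap w 0) (F.wordMap w 0 + F.wordRatio w) := by
  have h : F.wordMap w = fun x => F.wordRatio w * x + F.wordMap w 0 :=
    funext (F.wordMap_apply w)
  have h2 := Set.image_affine_Icc' (F.wordRatio_pos w) (F.wordMap w 0) 0 1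
  rw [← h] at h2
  rw [h2]
  congr 1 <;> ring

theorem mem_wordMap_image {w : List (Fin m)} {x : ℝ} :
    x ∈ F.wordMap w '' Icc 0 1 ↔
      F.wordMap w 0 ≤ x ∧ x ≤ F.wordMap w 0 + F.wordRatio w := by
  rw [wordMap_image, mem_Icc]

/-- The words `v` with `r_v ≤ r < r_{v⁻}`. -/
def AtLevel (r : ℝ) (v : List (Fin m)) : Prop :=
  F.wordRatio v ≤ r ∧ r < F.wordRatio v.dropLast

variable {F}

theorem AtLevel.ne_nil {r : ℝ} {v : List (Fin m)} (h : F.AtLevel r v) : v ≠ [] := by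
  rintro rfl
  exact absurd (h.1.trans_lt h.2) (lt_irrefl _)

theorem AtLevel.lt {r : ℝ} {v : List (Fin m)} (h : F.AtLevel r v) :
    F.minRatio * r < F.wordRatio v :=
  (mul_lt_mul_of_pos_left h.2 F.minRatio_pos).trans_le (F.minRatio_mul_wordRatio_dropLast_le v)

theorem AtLevel.append {r : ℝ} {u v : List (Fin m)} (h : F.AtLevel (r / F.wordRatio u) v) :
    F.AtLevel r (u ++ v) := by
  have hu := F.wordRatio_pos u
  have hne := h.ne_nil
  obtain ⟨h1, h2⟩ := h
  refine ⟨?_, ?_⟩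
  · rw [wordRatio_append, mul_comm]
    exact (le_div_iff₀ hu).1 h1
  · rw [List.dropLast_append_of_ne_nil hne, wordRatio_append, mul_comm]
    exact (div_lt_iff₀ hu).1 h2

theorem atLevel_singleton {r : ℝ} {j : Fin m} (hr : r < 1) (h : F.ratio j ≤ r) :
    F.AtLevel r [j] := ⟨by simpa using h, by simpa using hr⟩

theorem AtLevel.cons {r : ℝ} {j : Fin m} {v : List (Fin m)} (h : F.AtLevel (r / F.ratio j) v) :
    F.AtLevel r (j :: v) := by
  have : F.AtLevel (r / F.wordRatio [j]) v := by simpa using h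
  simpa using this.append

variable (F)

/-- Induction on the number of steps needed to reach the level `r`. -/
theorem level_induction {P : ℝ → Prop}
    (step : ∀ r, 0 < r → r < 1 → (∀ j, r < F.ratio j → P (r / F.ratio j)) → P r)
    {r : ℝ} (hr0 : 0 < r) (hr1 : r < 1) : P r := by
  obtain ⟨ρ, hρ0, hρ1, hρ⟩ := F.exists_ratio_le
  have key : ∀ n : ℕ, ∀ r, 0 < r → r < 1 → ρ ^ n ≤ r → P r := by
    intro n
    induction n with
    | zero => intro r _ h1 h; simp at h; linarith
    | succ n ih =>
      intro r h0 h1 h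
      refine step r h0 h1 fun j hj => ih _ (div_pos h0 (F.ratio_pos j))
        ((div_lt_one (F.ratio_pos j)).2 hj) ?_
      rw [le_div_iff₀ (F.ratio_pos j)]
      calc ρ ^ n * F.ratio j ≤ ρ ^ n * ρ := mul_le_mul_of_nonneg_left (hρ j) (by positivity)
        _ ≤ r := by rwa [← pow_succ]
  obtain ⟨n, hn⟩ := exists_pow_lt_of_lt_one hr0 hρ1
  exact key n r hr0 hr1 hn.le

/-! ### The unit interval as attractor, and a point of maximal multiplicity. -/

/-- The attractor of the system is the unit interval. -/
def UnitAttractor : Prop := ⋃ j, F.toFun j '' Icc 0 1 = Icc (0 : ℝ) 1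

variable {F}

theorem UnitAttractor.toFun_mem (hF : F.UnitAttractor) (j : Fin m) {x : ℝ}
    (hx : x ∈ Icc (0 : ℝ) 1) : F.toFun j x ∈ Icc (0 : ℝ) 1 := by
  rw [← hF]
  exact mem_iUnion.2 ⟨j, x, hx, rfl⟩

theorem UnitAttractor.wordMap_mem (hF : F.UnitAttractor) (w : List (Fin m)) {x : ℝ}
    (hx : x ∈ Icc (0 : ℝ) 1) : F.wordMap w x ∈ Icc (0 : ℝ) 1 := by
  induction w with
  | nil => exact hx
  | cons j w ih => exact hF.toFun_mem j ih

theorem UnitAttractor.exists_atLevel (hF : F.UnitAttractor) {r : ℝ} (hr0 : 0 < r) (hr1 : r < 1)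
    {x : ℝ} (hx : x ∈ Icc (0 : ℝ) 1) : ∃ v, F.AtLevel r v ∧ x ∈ F.wordMap v '' Icc 0 1 := by
  refine F.level_induction (P := fun r => ∀ x ∈ Icc (0 : ℝ) 1,
    ∃ v, F.AtLevel r v ∧ x ∈ F.wordMap v '' Icc 0 1) (fun r h0 h1 ih x hx => ?_) hr0 hr1 x hx
  rw [← hF] at hx
  obtain ⟨j, y, hy, rfl⟩ := mem_iUnion.1 hx
  by_cases hj : r < F.ratio j
  · obtain ⟨v, hv, z, hz, rfl⟩ := ih j hj y hy
    exact ⟨j :: v, hv.cons, z, hz, rfl⟩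
  · exact ⟨[j], atLevel_singleton h1 (not_lt.1 hj), y, hy, rfl⟩

theorem UnitAttractor.exists_atLevel_append (hF : F.UnitAttractor) {u : List (Fin m)} {r : ℝ}
    (hr0 : 0 < r) (hr1 : r < F.wordRatio u) {x : ℝ} (hx : x ∈ F.wordMap u '' Icc 0 1) :
    ∃ v, F.AtLevel (r / F.wordRatio u) v ∧ x ∈ F.wordMap (u ++ v) '' Icc 0 1 := by
  obtain ⟨y, hy, rfl⟩ := hx
  have hu := F.wordRatio_pos u
  obtain ⟨v, hv, z, hz, rfl⟩ := hF.exists_atLevel (div_pos hr0 hu) ((div_lt_one hu).2 hr1) hy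
  exact ⟨v, hv, z, hz, F.wordMap_append u v z⟩

/-- A point around which the maps of a given level are as many as possible: there, the maps of a
smaller copy of the system are all the maps that are present. -/
theorem WeakSeparation.exists_mapsAt_eq (hw : F.WeakSeparation) (hF : F.UnitAttractor) :
    ∃ x ∈ Icc (0 : ℝ) 1, ∃ r ∈ Ioo (0 : ℝ) 1, (F.mapsAt x r).Finite ∧
      ∀ w, F.mapsAt (F.wordMap w x) (F.wordRatio w * r) = (F.wordMap w ∘ ·) '' F.mapsAt x r := by
  obtain ⟨K, hK⟩ := hw
  have hfin : ∀ r ∈ Ioo (0 : ℝ) 1, ∀ x ∈ Icc (0 : ℝ) 1, (F.mapsAt x r).Finite := fun r hr x hx =>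
    Set.finite_of_encard_le_coe (hK r hr x hx)
  let S : Set ℕ := {n | ∃ x ∈ Icc (0 : ℝ) 1, ∃ r ∈ Ioo (0 : ℝ) 1, (F.mapsAt x r).ncard = n}
  have hS : S.Finite := by
    refine (Set.finite_Iic K).subset ?_
    rintro n ⟨x, hx, r, hr, rfl⟩
    have := hK r hr x hx
    rw [← (hfin r hr x hx).cast_ncard_eq] at this
    exact_mod_cast this
  have hne : S.Nonempty := ⟨_, 0, by simp, 1 / 2, by norm_num, rfl⟩
  obtain ⟨n, ⟨x, hx, r, hr, rfl⟩, hmax⟩ := Set.exists_max_image S id hS hne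
  refine ⟨x, hx, r, hr, hfin r hr x hx, fun w => ?_⟩
  have hwr : F.wordRatio w * r ∈ Ioo (0 : ℝ) 1 :=
    ⟨mul_pos (F.wordRatio_pos w) hr.1, by nlinarith [F.wordRatio_le_one w, hr.1, hr.2]⟩
  have hwx := hF.wordMap_mem w hx
  have hinj : Function.Injective (F.wordMap w ∘ · : (ℝ → ℝ) → ℝ → ℝ) := by
    refine Function.Injective.comp_left fun a b hab => ?_
    rw [wordMap_apply, F.wordMap_apply w b] at hab
    exact mul_left_cancel₀ (F.wordRatio_pos w).ne' (add_right_cancel hab)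
  -- Composing with S_w injects the maps at (x, r) into those at the scaled point and level;
  -- maximality leaves no room for any further map.
  refine (Set.eq_of_subset_of_ncard_le ?_ ?_ (hfin _ hwr _ hwx)).symm
  · rintro _ ⟨_, ⟨v, h1, h2, ⟨y, hy, rfl⟩, rfl⟩, rfl⟩
    have hlev : F.AtLevel (F.wordRatio w * r) (w ++ v) := by
      refine AtLevel.append ?_
      rw [mul_div_cancel_left₀ _ (F.wordRatio_pos w).ne']
      exact ⟨h1, h2⟩
    exact ⟨w ++ v, hlev.1, hlev.2, ⟨y, hy, F.wordMap_append w v y⟩,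
      funext fun z => (F.wordMap_append w v z).symm⟩
  · rw [Set.ncard_image_of_injective _ hinj]
    exact hmax _ ⟨_, hwx, _, hwr, rfl⟩

/-! ### Relative positions and overlaps of intervals. -/

variable (F)

/-- The position of `S_u([0,1])` relative to `S_v([0,1])`, that is, the length and the left endpoint
of `S_v⁻¹(S_u([0,1]))`. -/
noncomputable def relPos (v u : List (Fin m)) : ℝ × ℝ :=
  (F.wordRatio u / F.wordRatio v, (F.wordMap u 0 - F.wordMap v 0) / F.wordRatio v)

/-- The length of `S_u([0,1]) ∩ S_v([0,1])` if this is non-negative, and minus the distance of the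
two intervals otherwise. -/
noncomputable def overlap (u v : List (Fin m)) : ℝ :=
  min (F.wordMap u 0 + F.wordRatio u) (F.wordMap v 0 + F.wordRatio v) -
    max (F.wordMap u 0) (F.wordMap v 0)

theorem overlap_comm (u v : List (Fin m)) : F.overlap u v = F.overlap v u := by
  simp only [overlap, min_comm, max_comm]

theorem overlap_le_left (u v : List (Fin m)) : F.overlap u v ≤ F.wordRatio u := by
  have h1 := min_le_left (F.wordMap u 0 + F.wordRatio u) (F.wordMap v 0 + F.wordRatio v)
  have h2 := le_max_left (F.wordMap u 0) (F.wordMap v 0)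
  unfold overlap
  linarith

theorem overlap_le_right (u v : List (Fin m)) : F.overlap u v ≤ F.wordRatio v := by
  rw [overlap_comm]
  exact F.overlap_le_left v u

/-- Relative to r_v, the overlap depends on the relative position alone, so finitely many positions
yield finitely many relative overlaps. -/
theorem overlap_eq (u v : List (Fin m)) : F.overlap u v = F.wordRatio v *
    (min ((F.relPos v u).2 + (F.relPos v u).1) 1 - max (F.relPos v u).2 0) := by
  have hv := F.wordRatio_pos v
  rw [mul_sub, mul_min_of_nonneg _ _ hv.le, mul_max_of_nonneg _ _ hv.le, overlap]
  simp only [relPos, mul_add, mul_div_cancel₀ _ hv.ne', mul_one, mul_zero]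
  rw [← sub_eq_zero]
  have e1 := min_sub_sub_right (F.wordMap u 0 + F.wordRatio u) (F.wordMap v 0 + F.wordRatio v)
    (F.wordMap v 0)
  have e2 := max_sub_sub_right (F.wordMap u 0) (F.wordMap v 0) (F.wordMap v 0)
  rw [sub_self] at e2
  rw [add_sub_cancel_left] at e1
  rw [e2, sub_add_eq_add_sub, e1]
  ring

theorem relPos_concat (v u : List (Fin m)) (j : Fin m) : F.relPos v (u ++ [j]) =
    ((F.relPos v u).1 * F.ratio j, (F.relPos v u).1 * F.shift j + (F.relPos v u).2) := by
  simp only [relPos, wordRatio_concat, wordMap_concat_zero]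
  ext <;> simp only <;> ring

variable {F}

/-- Pairs of intervals with a substantial overlap have finitely many relative positions. -/
theorem WeakSeparation.finite_relPos (hw : F.WeakSeparation) (hF : F.UnitAttractor) {c : ℝ}
    (hc : 0 < c) : {p | ∃ u v, c * F.wordRatio u ≤ F.overlap u v ∧
      c * F.wordRatio v ≤ F.overlap u v ∧ p = F.relPos v u}.Finite := by
  obtain ⟨x, hx, r, hr, hfin, heq⟩ := hw.exists_mapsAt_eq hF
  have hl := F.minRatio_pos
  have hr0 := hr.1
  -- A lower bound for r_{u'}, where u' has level r_v r_w r / r_u: here r_w ≥ λc/2 and r_v ≥ c r_u,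
  -- and the outer λ is the loss within a level.
  set κ : ℝ := F.minRatio * (F.minRatio * (c / 2) * r * c) with hκ
  have hκ0 : 0 < κ := by positivity
  -- The position is read off from S_v⁻¹ ∘ S_u = S_w ∘ T ∘ S_{u'}⁻¹, with w, T and u' each ranging
  -- over a finite set.
  refine (((F.finite_le_wordRatio (κ := F.minRatio * (c / 2)) (by positivity)).prod
    (hfin.prod (F.finite_le_wordRatio hκ0))).image fun q : List (Fin m) × (ℝ → ℝ) × List (Fin m) =>
      (F.wordRatio q.1 * (q.2.1 1 - q.2.1 0) / F.wordRatio q.2.2,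
        F.wordMap q.1 (q.2.1 0) -
        F.wordRatio q.1 * (q.2.1 1 - q.2.1 0) / F.wordRatio q.2.2 * F.wordMap q.2.2 0)).subset ?_
  rintro _ ⟨u, v, hu, hv, rfl⟩
  have hru := F.wordRatio_pos u
  have hrv := F.wordRatio_pos v
  have hou := F.overlap_le_left u v
  have hov := F.overlap_le_right u v
  have hc1 : c ≤ 1 := by
    by_contra! h
    nlinarith
  -- an interval inside the overlap
  obtain ⟨y, hy⟩ : ∃ y, y = (min (F.wordMap u 0 + F.wordRatio u) (F.wordMap v 0 + F.wordRatio v) +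
    max (F.wordMap u 0) (F.wordMap v 0)) / 2 := ⟨_, rfl⟩
  have hpos : 0 < F.overlap u v := (mul_pos hc hru).trans_le hu
  have hm1 := min_le_left (F.wordMap u 0 + F.wordRatio u) (F.wordMap v 0 + F.wordRatio v)
  have hm2 := min_le_right (F.wordMap u 0 + F.wordRatio u) (F.wordMap v 0 + F.wordRatio v)
  have hm3 := le_max_left (F.wordMap u 0) (F.wordMap v 0)
  have hm4 := le_max_right (F.wordMap u 0) (F.wordMap v 0)
  have ho : F.overlap u v = min (F.wordMap u 0 + F.wordRatio u)
    (F.wordMap v 0 + F.wordRatio v) - max (F.wordMap u 0) (F.wordMap v 0) := rfl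
  have hyv : y ∈ F.wordMap v '' Icc 0 1 := by
    rw [mem_wordMap_image]
    constructor <;> linarith
  -- The overlap has length at least c r_v and midpoint y, so an interval of length at most c r_v /
  -- 2 through y stays inside it.
  obtain ⟨w, hwl, hyw⟩ := hF.exists_atLevel_append (u := v) (r := c / 2 * F.wordRatio v)
    (by positivity) (by nlinarith) hyv
  rw [mul_div_cancel_right₀ _ hrv.ne'] at hwl
  rw [mem_wordMap_image, wordRatio_append] at hyw
  have hwr := hwl.lt
  have hwle := hwl.1
  have hvw : F.wordRatio v * F.wordRatio w ≤ F.wordRatio v * (c / 2) :=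
    mul_le_mul_of_nonneg_left hwle hrv.le
  have hxvw : F.wordMap (v ++ w) x ∈ F.wordMap u '' Icc 0 1 := by
    have h1 : F.wordMap (v ++ w) x ∈ F.wordMap (v ++ w) '' Icc 0 1 := mem_image_of_mem _ hx
    rw [mem_wordMap_image, wordRatio_append] at h1
    rw [mem_wordMap_image]
    constructor <;> linarith [h1.1, h1.2, hyw.1, hyw.2]
  have hlev0 : 0 < F.wordRatio (v ++ w) * r := mul_pos (F.wordRatio_pos _) hr0
  have hlev1 : F.wordRatio (v ++ w) * r < F.wordRatio u := by
    have : F.wordRatio (v ++ w) * r ≤ F.wordRatio (v ++ w) :=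
      mul_le_of_le_one_right (F.wordRatio_pos _).le hr.2.le
    rw [wordRatio_append] at this ⊢
    linarith
  obtain ⟨u', hu'l, hu'⟩ := hF.exists_atLevel_append hlev0 hlev1 hxvw
  have hmem : F.wordMap (u ++ u') ∈ F.mapsAt (F.wordMap (v ++ w) x) (F.wordRatio (v ++ w) * r) :=
    ⟨u ++ u', hu'l.append.1, hu'l.append.2, hu', rfl⟩
  -- By maximality at x, the descendant S_{uu'} of S_u must be S_{vw} ∘ T with T among the finitely
  -- many maps at x.
  rw [heq] at hmem
  obtain ⟨T, hT, hTeq⟩ := hmem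
  have hru' := F.wordRatio_pos u'
  have hT0 : F.wordMap v (F.wordMap w (T 0)) = F.wordMap u (F.wordMap u' 0) := by
    have := congrFun hTeq 0
    simpa [wordMap_append] using this
  have hT1 : F.wordMap v (F.wordMap w (T 1)) = F.wordMap u (F.wordMap u' 1) := by
    have := congrFun hTeq 1
    simpa [wordMap_append] using this
  refine ⟨(w, T, u'), ⟨hwr.le, hT, ?_⟩, ?_⟩
  · refine le_trans ?_ hu'l.lt.le
    refine mul_le_mul_of_nonneg_left ?_ hl.le
    rw [le_div_iff₀ hru, wordRatio_append]
    calc F.minRatio * (c / 2) * r * c * F.wordRatio u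
        = F.minRatio * (c / 2) * r * (c * F.wordRatio u) := by ring
      _ ≤ F.minRatio * (c / 2) * r * F.wordRatio v :=
        mul_le_mul_of_nonneg_left (hu.trans hov) (by positivity)
      _ ≤ F.wordRatio w * r * F.wordRatio v := by gcongr
      _ = _ := by ring
  · rw [F.wordMap_apply v, F.wordMap_apply u, F.wordMap_apply w, F.wordMap_apply u' 1] at hT1
    rw [F.wordMap_apply v, F.wordMap_apply u, F.wordMap_apply w] at hT0
    have e1 : F.wordRatio w * (T 1 - T 0) / F.wordRatio u' =
        F.wordRatio u / F.wordRatio v := by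
      rw [div_eq_div_iff hru'.ne' hrv.ne']
      linear_combination hT1 - hT0
    simp only [relPos]
    rw [e1, F.wordMap_apply w]
    ext
    · rfl
    · simp only
      rw [eq_div_iff hrv.ne', sub_mul, div_mul_eq_mul_div, div_mul_cancel₀ _ hrv.ne']
      linear_combination hT0

/-! ### Lower bounds for overlaps, and balls inside gaps. -/

theorem UnitAttractor.shift_nonneg (hF : F.UnitAttractor) (j : Fin m) : 0 ≤ F.shift j := by
  have := (hF.toFun_mem j (x := 0) (by simp)).1
  simpa [toFun] using this

theorem UnitAttractor.ratio_add_shift_le (hF : F.UnitAttractor) (j : Fin m) :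
    F.ratio j + F.shift j ≤ 1 := by
  have := (hF.toFun_mem j (x := 1) (by simp)).2
  simpa [toFun] using this

theorem UnitAttractor.overlap_concat_le (hF : F.UnitAttractor) (u v : List (Fin m)) (j : Fin m) :
    F.overlap (u ++ [j]) v ≤ F.overlap u v := by
  have h0 := hF.shift_nonneg j
  have h1 := hF.ratio_add_shift_le j
  have hu := F.wordRatio_pos u
  unfold overlap
  rw [wordRatio_concat, wordMap_concat_zero]
  refine sub_le_sub (min_le_min_right _ ?_) (max_le_max_right _ ?_) <;> nlinarith

/-- If two intervals of comparable length have a small overlap, then any comparable child of the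
first that still meets the second has the same overlap with it. -/
theorem UnitAttractor.overlap_le_overlap_concat (hF : F.UnitAttractor) {c : ℝ}
    (hc : c ≤ F.minRatio ^ 2) (hc0 : ∀ j, 0 < F.shift j → c ≤ F.minRatio * F.shift j)
    (hc1 : ∀ j, 0 < 1 - F.ratio j - F.shift j → c ≤ F.minRatio * (1 - F.ratio j - F.shift j))
    {u v : List (Fin m)} {j : Fin m} {M : ℝ} (hu : F.minRatio * M ≤ F.wordRatio u)
    (hv : F.minRatio * M ≤ F.wordRatio v) (hM : 0 < M) (ho : F.overlap u v < c * M)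
    (hpos : 0 < F.overlap (u ++ [j]) v) : F.overlap u v ≤ F.overlap (u ++ [j]) v := by
  have hl := F.minRatio_pos
  have hl1 := F.minRatio_lt_one
  have hru := F.wordRatio_pos u
  have h0 := hF.shift_nonneg j
  have h1 := hF.ratio_add_shift_le j
  have hj := F.minRatio_le j
  have hcM : c * M ≤ F.minRatio * (F.minRatio * M) := by nlinarith
  have hcM' : F.minRatio * (F.minRatio * M) ≤ F.minRatio * M := by
    have : 0 < F.minRatio * M := by positivity
    nlinarith
  have huj : F.minRatio * (F.minRatio * M) ≤ F.wordRatio u * F.ratio j := by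
    rw [mul_comm]
    exact mul_le_mul hu hj hl.le hru.le
  have k0 : 0 < F.shift j → c * M ≤ F.wordRatio u * F.shift j := fun h => by
    nlinarith [hc0 j h, mul_le_mul_of_nonneg_right hu h.le,
      mul_le_mul_of_nonneg_right (hc0 j h) hM.le]
  have k1 : 0 < 1 - F.ratio j - F.shift j →
      c * M ≤ F.wordRatio u * (1 - F.ratio j - F.shift j) := fun h => by
    nlinarith [hc1 j h, mul_le_mul_of_nonneg_right hu h.le,
      mul_le_mul_of_nonneg_right (hc1 j h) hM.le]
  have n0 : 0 ≤ F.wordRatio u * F.shift j := mul_nonneg hru.le h0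
  have n1 : 0 ≤ F.wordRatio u * (1 - F.ratio j - F.shift j) := mul_nonneg hru.le (by linarith)
  unfold overlap at ho hpos ⊢
  rw [wordRatio_concat, wordMap_concat_zero] at hpos ⊢
  -- Both intervals are longer than cM, so the overlap sits at one end of S_u([0,1]). The child
  -- either reaches that end, and its length at least λ²M ≥ cM covers the overlap, or stays at least
  -- cM away from it, which contradicts `hpos`.
  rcases h0.eq_or_lt with e0 | l0
  · rw [← e0] at hpos n1 k1 ⊢
    rcases (show 0 ≤ 1 - F.ratio j - 0 by linarith).eq_or_lt with e1 | l1
    · have : F.ratio j = 1 := by linarith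
      exact absurd this (F.ratio_lt_one j).ne
    · have := k1 l1
      grind
  · have := k0 l0
    rcases (show 0 ≤ 1 - F.ratio j - F.shift j by linarith).eq_or_lt with e1 | l1
    · have e2 : F.wordRatio u * F.shift j + F.wordRatio u * F.ratio j = F.wordRatio u := by
        rw [← mul_add, show F.shift j + F.ratio j = 1 by linarith, mul_one]
      grind
    · have := k1 l1
      grind

/-- Intervals of comparable length do not have a small overlap. -/
theorem WeakSeparation.exists_le_overlap (hw : F.WeakSeparation) (hF : F.UnitAttractor) :
    ∃ c > 0, ∀ u v, F.minRatio * F.wordRatio u ≤ F.wordRatio v →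
      F.minRatio * F.wordRatio v ≤ F.wordRatio u → 0 < F.overlap u v →
      c * F.wordRatio u ≤ F.overlap u v ∧ c * F.wordRatio v ≤ F.overlap u v := by
  have hl := F.minRatio_pos
  have hl1 := F.minRatio_lt_one
  obtain ⟨d, hd, hdS⟩ := ((Set.finite_range F.shift).union
    (Set.finite_range fun j => 1 - F.ratio j - F.shift j)).exists_pos_le_of_pos
  obtain ⟨c, hc, hc2, hcd⟩ : ∃ c > 0, c ≤ F.minRatio ^ 2 ∧ c ≤ F.minRatio * d :=
    ⟨min (F.minRatio ^ 2) (F.minRatio * d), by positivity, min_le_left _ _, min_le_right _ _⟩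
  have hc0 : ∀ j, 0 < F.shift j → c ≤ F.minRatio * F.shift j := fun j hj =>
    hcd.trans (mul_le_mul_of_nonneg_left (hdS _ (Or.inl ⟨j, rfl⟩) hj) hl.le)
  have hc1 : ∀ j, 0 < 1 - F.ratio j - F.shift j → c ≤ F.minRatio * (1 - F.ratio j - F.shift j) :=
    fun j hj => hcd.trans (mul_le_mul_of_nonneg_left (hdS _ (Or.inr ⟨j, rfl⟩) hj) hl.le)
  -- These are the relative overlaps of v with the children of intervals that overlap v
  -- substantially: finitely many, so the positive ones are bounded below.
  obtain ⟨e, he, heS⟩ := (((hw.finite_relPos hF hc).prod (Set.finite_univ (α := Fin m))).image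
    fun q : (ℝ × ℝ) × Fin m => min ((q.1.1 * F.shift q.2 + q.1.2) + q.1.1 * F.ratio q.2) 1 -
      max (q.1.1 * F.shift q.2 + q.1.2) 0).exists_pos_le_of_pos
  obtain ⟨b, hb, hbe, hb1⟩ : ∃ b > 0, b ≤ e ∧ b ≤ 1 :=
    ⟨min e 1, by positivity, min_le_left _ _, min_le_right _ _⟩
  -- the shorter interval is `S_{uj}([0,1])`
  have step : ∀ u v j, F.wordRatio (u ++ [j]) ≤ F.wordRatio v →
      F.minRatio * F.wordRatio v ≤ F.wordRatio (u ++ [j]) → 0 < F.overlap (u ++ [j]) v →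
      (F.minRatio * F.wordRatio u ≤ F.wordRatio v →
        F.minRatio * F.wordRatio v ≤ F.wordRatio u → 0 < F.overlap u v →
        b * F.wordRatio u ≤ F.overlap u v ∧ b * F.wordRatio v ≤ F.overlap u v) →
      b * F.wordRatio v ≤ F.overlap (u ++ [j]) v := by
    intro u v j huv hvu hpos ih
    have hru := F.wordRatio_pos u
    have hrv := F.wordRatio_pos v
    have hpu : F.minRatio * F.wordRatio u ≤ F.wordRatio (u ++ [j]) := by
      simpa using F.minRatio_mul_wordRatio_dropLast_le (u ++ [j])
    have hup : F.wordRatio (u ++ [j]) ≤ F.wordRatio u := by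
      rw [wordRatio_concat]
      exact mul_le_of_le_one_right hru.le (F.ratio_lt_one j).le
    by_cases hbig : c * F.wordRatio u ≤ F.overlap u v ∧ c * F.wordRatio v ≤ F.overlap u v
    · rw [overlap_eq, relPos_concat] at hpos ⊢
      rw [mul_comm]
      refine mul_le_mul_of_nonneg_left (hbe.trans (heS _ ?_ (pos_of_mul_pos_right hpos hrv.le)))
        hrv.le
      exact ⟨(F.relPos v u, j), ⟨⟨u, v, hbig.1, hbig.2, rfl⟩, mem_univ _⟩, rfl⟩
    -- When the parent's overlap is small, the child loses none of it, so the parent's bound is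
    -- inherited with the same constant b.
    · have h1 := ih (hpu.trans huv) (hvu.trans hup)
        (hpos.trans_le (hF.overlap_concat_le u v j))
      refine h1.2.trans (hF.overlap_le_overlap_concat hc2 hc0 hc1
        (M := max (F.wordRatio u) (F.wordRatio v)) ?_ ?_ (lt_max_of_lt_left hru) ?_ hpos)
      · rw [mul_max_of_nonneg _ _ hl.le]
        exact max_le (by nlinarith) (hvu.trans hup)
      · rw [mul_max_of_nonneg _ _ hl.le]
        exact max_le (hpu.trans huv) (by nlinarith)
      · rw [mul_max_of_nonneg _ _ hc.le, lt_max_iff]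
        by_contra! h
        exact hbig h
  refine ⟨b, hb, fun u v => ?_⟩
  induction hn : u.length + v.length using Nat.strong_induction_on generalizing u v with
  | _ n ih =>
    intro huv hvu hpos
    rcases le_total (F.wordRatio u) (F.wordRatio v) with hle | hle
    · suffices h : b * F.wordRatio v ≤ F.overlap u v from
        ⟨(mul_le_mul_of_nonneg_left hle hb.le).trans h, h⟩
      rcases List.eq_nil_or_concat' u with rfl | ⟨u, j, rfl⟩
      -- If the shorter interval is all of [0,1], both words are empty and the overlap is 1; this is
      -- why b ≤ 1 is needed.
      · obtain rfl := F.eq_nil_of_one_le_wordRatio hle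
        simpa [overlap, wordMap] using hb1
      · refine step u v j hle hvu hpos (ih _ ?_ u v rfl)
        simp at hn
        omega
    · rw [overlap_comm] at hpos ⊢
      suffices h : b * F.wordRatio u ≤ F.overlap v u from
        ⟨h, (mul_le_mul_of_nonneg_left hle hb.le).trans h⟩
      rcases List.eq_nil_or_concat' v with rfl | ⟨v, j, rfl⟩
      · obtain rfl := F.eq_nil_of_one_le_wordRatio hle
        simpa [overlap, wordMap] using hb1
      · refine step v u j hle huv hpos (ih _ ?_ v u rfl)
        simp at hn
        omega

/-- Next to every `x` there is a ball of radius comparable to `r` that meets only those intervals of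
level `r` which contain `x`. -/
theorem WeakSeparation.exists_ball (hw : F.WeakSeparation) (hF : F.UnitAttractor) :
    ∃ κ > 0, ∀ r ∈ Ioo (0 : ℝ) 1, ∀ x ∈ Icc (0 : ℝ) 1, ∃ z ∈ Icc (0 : ℝ) 1, |z - x| ≤ r ∧
      ∀ u, F.AtLevel r u → (F.wordMap u '' Icc 0 1 ∩ Metric.closedBall z (κ * r)).Nonempty →
        x ∈ F.wordMap u '' Icc 0 1 := by
  have hl := F.minRatio_pos
  obtain ⟨c, hc, hover⟩ := hw.exists_le_overlap hF
  have hfin := hw.finite_relPos hF hc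
  -- The set Z consists of the left and right endpoints in all substantial relative positions,
  -- together with 0 and 1.
  obtain ⟨κ, hκ, hgap⟩ := (((hfin.image fun p : ℝ × ℝ => p.2).union
    (hfin.image fun p : ℝ × ℝ => p.2 + p.1)).union (Set.toFinite {0, 1})).exists_gap
      (Or.inr (by simp)) (Or.inr (by simp))
  refine ⟨κ * F.minRatio, by positivity, fun r hr x hx => ?_⟩
  obtain ⟨v, hv, y, hy, rfl⟩ := hF.exists_atLevel hr.1 hr.2 hx
  have hrv := F.wordRatio_pos v
  have hvl := hv.lt
  obtain ⟨z, hz, hz0, hz1, hzg⟩ := hgap y hy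
  refine ⟨F.wordMap v z, hF.wordMap_mem v hz, ?_, fun u hu => ?_⟩
  · rw [F.wordMap_apply v z, F.wordMap_apply v y, add_sub_add_right_eq_sub, ← mul_sub, abs_mul,
      abs_of_pos hrv]
    have : |z - y| ≤ 1 := abs_le.2 ⟨by linarith [hz.1, hy.2], by linarith [hz.2, hy.1]⟩
    exact (mul_le_of_le_one_right hrv.le this).trans hv.1
  · rintro ⟨t, htu, htz⟩
    have hru := F.wordRatio_pos u
    rw [mem_wordMap_image] at htu ⊢
    rw [Metric.mem_closedBall, Real.dist_eq, abs_le, F.wordMap_apply v z] at htz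
    have hκr : κ * F.minRatio * r ≤ F.wordRatio v * κ := by nlinarith
    have e1 : F.wordMap u 0 = F.wordRatio v * (F.relPos v u).2 + F.wordMap v 0 := by
      simp only [relPos]
      rw [mul_div_cancel₀ _ hrv.ne']
      ring
    have e2 : F.wordRatio u = F.wordRatio v * (F.relPos v u).1 := by
      simp only [relPos]
      rw [mul_div_cancel₀ _ hrv.ne']
    have ha : (F.relPos v u).2 ≤ z + κ := by
      refine le_of_mul_le_mul_left ?_ hrv
      linarith [htu.1, htz.2]
    have hb : z - κ ≤ (F.relPos v u).2 + (F.relPos v u).1 := by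
      refine le_of_mul_le_mul_left ?_ hrv
      linarith [htu.2, htz.1]
    have hrel : 0 < (F.relPos v u).1 := div_pos hru hrv
    -- The ball lies in the open interior of S_v([0,1]), so meeting it forces a positive overlap and
    -- not mere touching.
    have hpos : 0 < F.overlap u v := by
      rw [overlap_eq]
      refine mul_pos hrv (sub_pos.2 (max_lt (lt_min ?_ ?_) (lt_min ?_ ?_))) <;> linarith
    have hul := hu.lt
    obtain ⟨h1, h2⟩ := hover u v (by nlinarith [hu.1]) (by nlinarith [hv.1]) hpos
    have hmem : F.relPos v u ∈ {p | ∃ u v, c * F.wordRatio u ≤ F.overlap u v ∧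
      c * F.wordRatio v ≤ F.overlap u v ∧ p = F.relPos v u} := ⟨u, v, h1, h2, rfl⟩
    obtain ⟨k1, k2⟩ := hzg _ (Or.inl (Or.inl ⟨_, hmem, rfl⟩)) _ (Or.inl (Or.inr ⟨_, hmem, rfl⟩))
      ha hb
    rw [F.wordMap_apply v y]
    constructor <;> nlinarith

end WeightedIFS


/-! ### Estimates for the self-similar measure. -/

/-- The measures of concentric balls of radii `r` and `2r` differ at most by a factor that grows
more slowly than any power of `1/r`. -/
def QuasiDoubling (μ : Measure ℝ) : Prop :=
  ∀ ε : ℝ, 0 < ε → ∃ C : ℝ, 0 < C ∧ ∀ r ∈ Ioo (0 : ℝ) 1, ∀ x ∈ μ.support,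
    C * r ^ ε * μ.real (Metric.closedBall x (2 * r)) ≤ μ.real (Metric.closedBall x r)

/-- All balls centred in the support have measure at least a power of the radius. -/
def PowerLowerBound (μ : Measure ℝ) : Prop :=
  ∃ c > 0, ∃ s : ℝ, 0 ≤ s ∧ ∀ x ∈ μ.support, ∀ r ∈ Ioc (0 : ℝ) 1,
    c * r ^ s ≤ μ.real (Metric.closedBall x r)

theorem measureReal_support {μ : Measure ℝ} [IsProbabilityMeasure μ] : μ.real μ.support = 1 := by
  rw [measureReal_def, (prob_compl_eq_zero_iff₀ Measure.nullMeasurableSet_support).1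
    Measure.measure_compl_support, ENNReal.toReal_one]

theorem measureReal_closedBall_mono {μ : Measure ℝ} [IsProbabilityMeasure μ] {x r R : ℝ}
    (h : r ≤ R) : μ.real (Metric.closedBall x r) ≤ μ.real (Metric.closedBall x R) :=
  measureReal_mono (Metric.closedBall_subset_closedBall h)

namespace WeightedIFS

variable {m : ℕ} {F : WeightedIFS m} {μ : Measure ℝ}

theorem measurable_toFun (j : Fin m) : Measurable (F.toFun j) := by
  unfold toFun
  fun_prop

theorem IsSelfSimilarMeasure.real_eq (hμ : F.IsSelfSimilarMeasure μ) {E : Set ℝ}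
    (hE : MeasurableSet E) : μ.real E = ∑ j, F.prob j * μ.real (F.toFun j ⁻¹' E) := by
  have := hμ.1
  rw [measureReal_def, hμ.2 E hE, ENNReal.toReal_sum fun j _ =>
    ENNReal.mul_ne_top ENNReal.ofReal_ne_top (measure_ne_top _ _)]
  refine Finset.sum_congr rfl fun j _ => ?_
  rw [ENNReal.toReal_mul, ENNReal.toReal_ofReal (F.prob_pos j).le, measureReal_def]

theorem IsSelfSimilarMeasure.prob_mul_le (hμ : F.IsSelfSimilarMeasure μ) {E : Set ℝ}
    (hE : MeasurableSet E) (j : Fin m) : F.prob j * μ.real (F.toFun j ⁻¹' E) ≤ μ.real E := by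
  rw [hμ.real_eq hE]
  exact Finset.single_le_sum (f := fun j => F.prob j * μ.real (F.toFun j ⁻¹' E))
    (fun i _ => mul_nonneg (F.prob_pos i).le measureReal_nonneg) (Finset.mem_univ j)

/-- Positive weights make the support stable under each S_j; conversely, the union of the images is
closed and has full measure, so it contains the support. -/
theorem IsSelfSimilarMeasure.unitAttractor (hμ : F.IsSelfSimilarMeasure μ)
    (hsupp : μ.support = Icc (0 : ℝ) 1) : F.UnitAttractor := by
  have := hμ.1
  refine subset_antisymm (iUnion_subset fun j => ?_) ?_
  · rintro _ ⟨x, hx, rfl⟩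
    rw [← hsupp] at hx ⊢
    rw [Measure.mem_support_iff_forall] at hx ⊢
    intro U hU
    obtain ⟨V, hVU, hV, hxV⟩ := mem_nhds_iff.1 hU
    have hcont : Continuous (F.toFun j) := by unfold toFun; fun_prop
    have h1 : 0 < μ (F.toFun j ⁻¹' V) := hx _ (hcont.continuousAt.preimage_mem_nhds
      (hV.mem_nhds hxV))
    refine lt_of_lt_of_le ?_ (measure_mono hVU)
    rw [hμ.2 V hV.measurableSet]
    refine lt_of_lt_of_le (ENNReal.mul_pos (ENNReal.ofReal_pos.2 (F.prob_pos j)).ne' h1.ne') ?_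
    exact Finset.single_le_sum (f := fun j => ENNReal.ofReal (F.prob j) * μ (F.toFun j ⁻¹' V))
      (fun _ _ => zero_le) (Finset.mem_univ j)
  · have hcl : IsClosed (⋃ j, F.toFun j '' Icc (0 : ℝ) 1) := by
      refine isClosed_iUnion_of_finite fun j => (isCompact_Icc.image ?_).isClosed
      unfold toFun
      fun_prop
    refine hsupp.symm.subset.trans (Measure.support_subset_of_isClosed hcl ?_)
    rw [mem_ae_iff, hμ.2 _ hcl.isOpen_compl.measurableSet]
    refine Finset.sum_eq_zero fun j _ => ?_
    rw [mul_eq_zero]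
    right
    refine measure_mono_null ?_ (Measure.measure_compl_support (μ := μ))
    rw [hsupp]
    intro x hx hx1
    exact hx (mem_iUnion.2 ⟨j, x, hx1, rfl⟩)

/-- Iterated up to level r, self-similarity writes μ as a positive combination of its images under
the S_v. Induction on the level transfers the inequality without writing out that sum. -/
theorem IsSelfSimilarMeasure.mul_le_of_atLevel (hμ : F.IsSelfSimilarMeasure μ) {t r : ℝ}
    (hr0 : 0 < r) (hr1 : r < 1) {E E' : Set ℝ} (hE : MeasurableSet E) (hE' : MeasurableSet E')
    (h : ∀ v, F.AtLevel r v → t * μ.real (F.wordMap v ⁻¹' E) ≤ μ.real (F.wordMap v ⁻¹' E')) :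
    t * μ.real E ≤ μ.real E' := by
  refine F.level_induction (P := fun r => ∀ E E', MeasurableSet E → MeasurableSet E' →
    (∀ v, F.AtLevel r v → t * μ.real (F.wordMap v ⁻¹' E) ≤ μ.real (F.wordMap v ⁻¹' E')) →
    t * μ.real E ≤ μ.real E') (fun r h0 h1 ih E E' hE hE' h => ?_) hr0 hr1 E E' hE hE' h
  rw [hμ.real_eq hE, hμ.real_eq hE', Finset.mul_sum]
  refine Finset.sum_le_sum fun j _ => ?_
  rw [mul_left_comm]
  refine mul_le_mul_of_nonneg_left ?_ (F.prob_pos j).le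
  by_cases hj : r < F.ratio j
  · exact ih j hj _ _ (measurable_toFun j hE) (measurable_toFun j hE') fun v hv =>
      h (j :: v) hv.cons
  · exact h [j] (atLevel_singleton h1 (not_lt.1 hj))

variable (F) in
theorem exists_rpow_le_prob : ∃ s : ℝ, 0 ≤ s ∧ ∀ j, F.ratio j ^ s ≤ F.prob j := by
  obtain ⟨b, hb⟩ := (Set.finite_range fun j => Real.logb (F.ratio j) (F.prob j)).bddAbove
  refine ⟨max b 0, le_max_right _ _, fun j => ?_⟩
  calc F.ratio j ^ max b 0 ≤ F.ratio j ^ Real.logb (F.ratio j) (F.prob j) :=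
        Real.rpow_le_rpow_of_exponent_ge (F.ratio_pos j) (F.ratio_lt_one j).le
          ((hb ⟨j, rfl⟩).trans (le_max_left _ _))
    _ = F.prob j := Real.rpow_logb (F.ratio_pos j) (F.ratio_lt_one j).ne (F.prob_pos j)

theorem IsSelfSimilarMeasure.rpow_le_image (hμ : F.IsSelfSimilarMeasure μ)
    (hsupp : μ.support = Icc (0 : ℝ) 1) {s : ℝ} (hs : ∀ j, F.ratio j ^ s ≤ F.prob j)
    (w : List (Fin m)) : F.wordRatio w ^ s ≤ μ.real (F.wordMap w '' Icc 0 1) := by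
  have := hμ.1
  induction w with
  | nil =>
    have h : μ.real (Icc (0 : ℝ) 1) = 1 := hsupp ▸ measureReal_support
    simp [wordMap, h]
  | cons j w ih =>
    have hmeas : MeasurableSet (F.wordMap (j :: w) '' Icc 0 1) := by
      rw [wordMap_image]
      exact measurableSet_Icc
    rw [wordRatio_cons, Real.mul_rpow (F.ratio_pos j).le (F.wordRatio_pos w).le]
    refine le_trans ?_ (hμ.prob_mul_le hmeas j)
    refine mul_le_mul (hs j) (ih.trans (measureReal_mono ?_))
      (Real.rpow_nonneg (F.wordRatio_pos w).le _) (F.prob_pos j).le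
    rintro _ ⟨x, hx, rfl⟩
    exact ⟨x, hx, rfl⟩

theorem IsSelfSimilarMeasure.powerLowerBound (hμ : F.IsSelfSimilarMeasure μ)
    (hsupp : μ.support = Icc (0 : ℝ) 1) : PowerLowerBound μ := by
  have := hμ.1
  obtain ⟨s, hs0, hs⟩ := F.exists_rpow_le_prob
  have hl := F.minRatio_pos
  refine ⟨(F.minRatio / 2) ^ s, by positivity, s, hs0, fun x hx r hr => ?_⟩
  have hr0 := hr.1
  rw [hsupp] at hx
  -- The level is halved because r = 1 is allowed and levels must be below 1.
  obtain ⟨v, hv, hxv⟩ := (hμ.unitAttractor hsupp).exists_atLevel (r := r / 2) (by positivity)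
    (by linarith [hr.2]) hx
  have hvl := hv.lt
  have hv1 := hv.1
  calc (F.minRatio / 2) ^ s * r ^ s = (F.minRatio * (r / 2)) ^ s := by
        rw [← Real.mul_rpow (by positivity) hr.1.le]
        ring_nf
    _ ≤ F.wordRatio v ^ s := Real.rpow_le_rpow (by positivity) hvl.le hs0
    _ ≤ μ.real (F.wordMap v '' Icc 0 1) := hμ.rpow_le_image hsupp hs v
    _ ≤ μ.real (Metric.closedBall x r) := measureReal_mono fun y hy => by
        rw [mem_wordMap_image] at hy hxv
        rw [Metric.mem_closedBall, Real.dist_eq, abs_le]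
        constructor <;> linarith

/-- Compare the two balls under each S_v of level R. If S_v([0,1]) meets the ball at z, then x =
S_v(y), and the preimage of B(x, r) contains B(y, r/R) since r_v ≤ R; otherwise the ball at z has a
null preimage. -/
theorem IsSelfSimilarMeasure.exists_rpow_mul_le (hμ : F.IsSelfSimilarMeasure μ)
    (hsupp : μ.support = Icc (0 : ℝ) 1) (hw : F.WeakSeparation) :
    ∃ κ > 0, ∃ c > 0, ∃ s : ℝ, 0 ≤ s ∧ ∀ R ∈ Ioo (0 : ℝ) 1, ∀ x ∈ μ.support, ∃ z ∈ μ.support,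
      |z - x| ≤ R ∧ ∀ r, 0 < r → r ≤ R →
        c * (r / R) ^ s * μ.real (Metric.closedBall z (κ * R)) ≤
          μ.real (Metric.closedBall x r) := by
  have := hμ.1
  obtain ⟨κ, hκ, hball⟩ := hw.exists_ball (hμ.unitAttractor hsupp)
  obtain ⟨c, hc, s, hs, hlow⟩ := hμ.powerLowerBound hsupp
  refine ⟨κ, hκ, c, hc, s, hs, fun R hR x hx => ?_⟩
  rw [hsupp] at hx
  obtain ⟨z, hz, hzx, hzv⟩ := hball R hR x hx
  refine ⟨z, hsupp ▸ hz, hzx, fun r hr hrR => ?_⟩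
  have hR0 := hR.1
  refine hμ.mul_le_of_atLevel hR.1 hR.2 Metric.isClosed_closedBall.measurableSet
    Metric.isClosed_closedBall.measurableSet fun v hv => ?_
  by_cases hne : (F.wordMap v '' Icc 0 1 ∩ Metric.closedBall z (κ * R)).Nonempty
  · obtain ⟨y, hy, rfl⟩ := hzv v hv hne
    calc c * (r / R) ^ s * μ.real (F.wordMap v ⁻¹' Metric.closedBall z (κ * R))
        ≤ c * (r / R) ^ s := mul_le_of_le_one_right (by positivity) measureReal_le_one
      _ ≤ μ.real (Metric.closedBall y (r / R)) :=
          hlow y (hsupp ▸ hy) _ ⟨by positivity, (div_le_one hR0).2 hrR⟩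
      _ ≤ _ := measureReal_mono fun t ht => ?_
    rw [Metric.mem_closedBall, Real.dist_eq, le_div_iff₀ hR0] at ht
    rw [mem_preimage, Metric.mem_closedBall, Real.dist_eq, F.wordMap_apply v t,
      F.wordMap_apply v y, add_sub_add_right_eq_sub, ← mul_sub, abs_mul,
      abs_of_pos (F.wordRatio_pos v), mul_comm]
    exact (mul_le_mul_of_nonneg_left hv.1 (abs_nonneg _)).trans ht
  · have h0 : μ.real (F.wordMap v ⁻¹' Metric.closedBall z (κ * R)) = 0 := by
      rw [measureReal_eq_zero_iff]
      refine measure_mono_null ?_ (Measure.measure_compl_support (μ := μ))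
      rw [hsupp]
      intro y hy hy1
      exact hne ⟨_, mem_image_of_mem _ hy1, hy⟩
    rw [h0, mul_zero]
    exact measureReal_nonneg

end WeightedIFS

/-! ### Quasi-doubling and the quasi-Assouad dimension. -/

variable {μ : Measure ℝ}

theorem measureReal_closedBall_pos [IsProbabilityMeasure μ] {x r : ℝ} (hx : x ∈ μ.support)
    (hr : 0 < r) : 0 < μ.real (Metric.closedBall x r) :=
  ENNReal.toReal_pos ((Measure.mem_support_iff_forall x).1 hx _
    (Metric.closedBall_mem_nhds x hr)).ne' (measure_ne_top _ _)

/-- Doubling is iterated, with ε halved at each stage. Once 2^n r ≥ 1 it no longer applies, but then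
r is bounded below and the power bound suffices. -/
theorem QuasiDoubling.exists_rpow_mul_le [IsProbabilityMeasure μ] (h : QuasiDoubling μ)
    (hlow : PowerLowerBound μ) (D : ℝ) {ε : ℝ} (hε : 0 < ε) :
    ∃ C > 0, ∀ r ∈ Ioo (0 : ℝ) 1, ∀ x ∈ μ.support,
      C * r ^ ε * μ.real (Metric.closedBall x (D * r)) ≤ μ.real (Metric.closedBall x r) := by
  obtain ⟨c, hc, s, hs, hlow⟩ := hlow
  have key : ∀ n : ℕ, ∀ ε : ℝ, 0 < ε → ∃ C > 0, ∀ r ∈ Ioo (0 : ℝ) 1, ∀ x ∈ μ.support,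
      C * r ^ ε * μ.real (Metric.closedBall x (2 ^ n * r)) ≤ μ.real (Metric.closedBall x r) := by
    intro n
    induction n with
    | zero =>
      refine fun ε hε => ⟨1, one_pos, fun r hr x _ => ?_⟩
      rw [pow_zero, one_mul, one_mul]
      exact mul_le_of_le_one_left measureReal_nonneg (Real.rpow_le_one hr.1.le hr.2.le hε.le)
    | succ n ih =>
      intro ε hε
      obtain ⟨C, hC, hCr⟩ := ih (ε / 2) (half_pos hε)
      obtain ⟨C', hC', hCr'⟩ := h (ε / 2) (half_pos hε)
      refine ⟨min (C * C') (c * ((2 ^ n)⁻¹) ^ s), by positivity, fun r hr x hx => ?_⟩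
      have hr0 := hr.1
      by_cases hr1 : 2 ^ n * r < 1
      · have e1 : r ^ ε = r ^ (ε / 2) * r ^ (ε / 2) := by
          rw [← Real.rpow_add hr0, add_halves]
        have e2 : r ^ (ε / 2) ≤ (2 ^ n * r) ^ (ε / 2) :=
          Real.rpow_le_rpow hr0.le (le_mul_of_one_le_left hr0.le (one_le_pow₀ one_le_two))
            (by positivity)
        have h1 := hCr r hr x hx
        have h2 := hCr' (2 ^ n * r) ⟨by positivity, hr1⟩ x hx
        rw [← mul_assoc, ← pow_succ'] at h2
        calc _ ≤ C * C' * r ^ ε * μ.real (Metric.closedBall x (2 ^ (n + 1) * r)) := by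
              gcongr
              exact min_le_left _ _
          _ = C * r ^ (ε / 2) *
              (C' * r ^ (ε / 2) * μ.real (Metric.closedBall x (2 ^ (n + 1) * r))) := by
              rw [e1]; ring
          _ ≤ C * r ^ (ε / 2) * μ.real (Metric.closedBall x (2 ^ n * r)) := by
              gcongr
              refine le_trans ?_ h2
              gcongr
          _ ≤ _ := h1
      · have h1 : (2 ^ n)⁻¹ ≤ r := by
          rw [inv_le_iff_one_le_mul₀ (by positivity), mul_comm]
          exact not_lt.1 hr1
        calc _ ≤ c * ((2 ^ n)⁻¹) ^ s * 1 * 1 := by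
              gcongr
              · exact min_le_right _ _
              · exact Real.rpow_le_one hr0.le hr.2.le hε.le
              · exact measureReal_le_one
          _ ≤ c * r ^ s := by
              rw [mul_one, mul_one]
              gcongr
          _ ≤ _ := hlow x hx r ⟨hr0, hr.2.le⟩
  obtain ⟨n, hn⟩ := pow_unbounded_of_one_lt D one_lt_two
  obtain ⟨C, hC, hCr⟩ := key n ε hε
  refine ⟨C, hC, fun r hr x hx => le_trans ?_ (hCr r hr x hx)⟩
  have hr0 := hr.1
  have := measureReal_closedBall_mono (μ := μ) (x := x) (mul_le_mul_of_nonneg_right hn.le hr0.le)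
  gcongr

theorem QuasiDoubling.of_dim_lt_top [IsProbabilityMeasure μ] (hlow : PowerLowerBound μ)
    (h : quasiAssouadDim μ < ⊤) : QuasiDoubling μ := by
  obtain ⟨c, hc, t, ht, hlow⟩ := hlow
  obtain ⟨b, hb, -⟩ := EReal.lt_iff_exists_real_btwn.1 h
  set s : ℝ := max b 1 with hs
  have hs0 : 0 < s := lt_max_of_lt_right one_pos
  intro ε hε
  -- With R^(1+δ) = r, this choice gives (R/r)^s = R^(-δs) = R^(-ε) ≤ r^(-ε).
  set δ : ℝ := ε / s with hδ
  have hδ0 : 0 < δ := by positivity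
  have hH : quasiAssouadH μ δ < (b : EReal) :=
    (le_iSup (fun δ : Ioi (0 : ℝ) => quasiAssouadH μ δ) ⟨δ, hδ0⟩).trans_lt hb
  obtain ⟨_, ⟨a, ⟨C₁, hC₁, C₂, hC₂, H⟩, rfl⟩, hab⟩ := sInf_lt_iff.1 hH
  have has : a ≤ s := (EReal.coe_lt_coe_iff.1 hab).le.trans (le_max_left _ _)
  have hlim : Filter.Tendsto (fun r : ℝ => r ^ (1 + δ)⁻¹) (nhds 0) (nhds 0) := by
    have := (Real.continuousAt_rpow_const 0 (1 + δ)⁻¹ (Or.inr (by positivity))).tendsto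
    rwa [Real.zero_rpow (by positivity)] at this
  have hlim2 : Filter.Tendsto (fun r : ℝ => r ^ (1 - (1 + δ)⁻¹)) (nhds 0) (nhds 0) := by
    have hp : 0 < 1 - (1 + δ)⁻¹ := sub_pos.2 (inv_lt_one_of_one_lt₀ (by linarith))
    have := (Real.continuousAt_rpow_const 0 (1 - (1 + δ)⁻¹) (Or.inr hp.le)).tendsto
    rwa [Real.zero_rpow hp.ne'] at this
  obtain ⟨r₀, hr₀, hsmall⟩ := Metric.eventually_nhds_iff_ball.1
    ((hlim.eventually_lt_const hC₁).and (hlim2.eventually_lt_const (half_pos one_pos)))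
  refine ⟨min C₂⁻¹ (c * (min r₀ 1) ^ t), by positivity, fun r hr x hx => ?_⟩
  have hr0 := hr.1
  by_cases hrr : r < r₀
  · obtain ⟨h1, h2⟩ := hsmall r (by simpa [abs_of_pos hr0] using hrr)
    set R : ℝ := r ^ (1 + δ)⁻¹ with hR
    have hR0 : 0 < R := by positivity
    have hRδ : R ^ (1 + δ) = r := by
      rw [hR, ← Real.rpow_mul hr0.le, inv_mul_cancel₀ (by positivity), Real.rpow_one]
    have hRr : r ^ (1 - (1 + δ)⁻¹) = r / R := by
      rw [Real.rpow_sub hr0, Real.rpow_one]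
    rw [hRr, div_lt_iff₀ hR0] at h2
    have h2R : 2 * r ≤ R := by linarith
    have hrR : r ≤ R := by linarith
    have hpos := measureReal_closedBall_pos hx hr0
    have hH := H r R hr0 hRδ.ge (hRδ.trans_le hrR) h1.le x hx
    rw [div_le_iff₀ hpos] at hH
    have hR1 : R ≤ 1 := Real.rpow_le_one hr0.le hr.2.le (by positivity)
    have hdivR : R / r = R ^ (-δ) := by
      rw [← hRδ, div_eq_iff (by positivity), ← Real.rpow_add hR0]
      simp
    have hpow : (R / r) ^ a ≤ (r ^ ε)⁻¹ := by
      calc (R / r) ^ a ≤ (R / r) ^ s :=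
            Real.rpow_le_rpow_of_exponent_le ((one_le_div hr0).2 hrR) has
        _ = R ^ (-ε) := by
            rw [hdivR, ← Real.rpow_mul hR0.le, neg_mul, hδ, div_mul_cancel₀ _ hs0.ne']
        _ = (R ^ ε)⁻¹ := Real.rpow_neg hR0.le _
        _ ≤ (r ^ ε)⁻¹ := by gcongr
    have hmono := measureReal_closedBall_mono (μ := μ) (x := x) h2R
    calc _ ≤ C₂⁻¹ * r ^ ε * μ.real (Metric.closedBall x R) := by
          gcongr
          exact min_le_left _ _
      _ ≤ C₂⁻¹ * r ^ ε * (C₂ * (r ^ ε)⁻¹ * μ.real (Metric.closedBall x r)) := by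
          gcongr
          refine hH.trans ?_
          gcongr
      _ = _ := by
          have : r ^ ε ≠ 0 := (Real.rpow_pos_of_pos hr0 _).ne'
          field_simp
  · calc _ ≤ c * (min r₀ 1) ^ t * 1 * 1 := by
          gcongr
          · exact min_le_right _ _
          · exact Real.rpow_le_one hr0.le hr.2.le hε.le
          · exact measureReal_le_one
      _ ≤ c * r ^ t := by
          rw [mul_one, mul_one]
          gcongr
          exact (min_le_left _ _).trans (not_lt.1 hrr)
      _ ≤ _ := hlow x hx r ⟨hr0, hr.2.le⟩

namespace WeightedIFS

variable {m : ℕ} {F : WeightedIFS m}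

theorem IsSelfSimilarMeasure.dim_lt_top (hμ : F.IsSelfSimilarMeasure μ)
    (hsupp : μ.support = Icc (0 : ℝ) 1) (hw : F.WeakSeparation) (h : QuasiDoubling μ) :
    quasiAssouadDim μ < ⊤ := by
  have := hμ.1
  obtain ⟨κ, hκ, c, hc, s, hs, hz⟩ := hμ.exists_rpow_mul_le hsupp hw
  refine lt_of_le_of_lt (iSup_le ?_) (EReal.coe_lt_top (s + 1))
  rintro ⟨δ, hδ⟩
  -- The exponent s comes from the power bound and does not depend on δ; the extra 1 absorbs the
  -- quasi-doubling loss through r/R ≤ R^δ.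
  refine sInf_le ⟨s + 1, ?_, rfl⟩
  obtain ⟨C, hC, hCr⟩ := h.exists_rpow_mul_le (hμ.powerLowerBound hsupp) (2 / κ) hδ
  refine ⟨min (1 / 2) (κ⁻¹ / 2), by positivity, (c * C * κ ^ δ)⁻¹, by positivity,
    fun r R hr hrR hRR hRC x hx => ?_⟩
  have hR : 0 < R := (hr.trans_le hrR).trans_le hRR
  have hR1 : R < 1 := (hRC.trans (min_le_left _ _)).trans_lt (by norm_num)
  have hκR : κ * R < 1 := by
    have h1 := hRC.trans (min_le_right _ _)
    have h2 := mul_le_mul_of_nonneg_left h1 hκ.le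
    have h3 : κ * (κ⁻¹ / 2) = 1 / 2 := by field_simp
    linarith
  obtain ⟨z, hzs, hzx, hzr⟩ := hz R ⟨hR, hR1⟩ x hx
  have h1 := hzr r hr (hrR.trans hRR)
  have h2 := hCr (κ * R) ⟨by positivity, hκR⟩ z hzs
  rw [show 2 / κ * (κ * R) = 2 * R by field_simp] at h2
  have h3 : μ.real (Metric.closedBall x R) ≤ μ.real (Metric.closedBall z (2 * R)) := by
    refine measureReal_mono (Metric.closedBall_subset_closedBall' ?_)
    rw [dist_comm, Real.dist_eq]
    linarith
  have h4 : r / R ≤ R ^ δ := by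
    rw [div_le_iff₀ hR]
    rwa [add_comm, Real.rpow_add hR, Real.rpow_one] at hrR
  have hpos := measureReal_closedBall_pos hx hr
  rw [div_le_iff₀ hpos]
  have hinv : (R / r) ^ (s + 1) * (r / R) ^ (s + 1) = 1 := by
    rw [← Real.mul_rpow (by positivity) (by positivity), div_mul_div_cancel₀ hr.ne',
      div_self hR.ne', Real.one_rpow]
  have hmain : c * C * κ ^ δ * (r / R) ^ (s + 1) * μ.real (Metric.closedBall x R) ≤
      μ.real (Metric.closedBall x r) := by
    calc _ = c * (r / R) ^ s * (C * (κ ^ δ * (r / R)) * μ.real (Metric.closedBall x R)) := by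
          rw [Real.rpow_add (by positivity), Real.rpow_one]
          ring
      _ ≤ c * (r / R) ^ s * (C * (κ ^ δ * R ^ δ) * μ.real (Metric.closedBall z (2 * R))) := by
          gcongr
      _ ≤ c * (r / R) ^ s * μ.real (Metric.closedBall z (κ * R)) := by
          rw [← Real.mul_rpow hκ.le hR.le]
          gcongr
      _ ≤ _ := h1
  calc μ.real (Metric.closedBall x R)
      = (c * C * κ ^ δ)⁻¹ * (R / r) ^ (s + 1) *
        (c * C * κ ^ δ * (r / R) ^ (s + 1) * μ.real (Metric.closedBall x R)) := by
        have : c * C * κ ^ δ ≠ 0 := by positivity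
        rw [show (c * C * κ ^ δ)⁻¹ * (R / r) ^ (s + 1) *
          (c * C * κ ^ δ * (r / R) ^ (s + 1) * μ.real (Metric.closedBall x R)) =
          ((c * C * κ ^ δ)⁻¹ * (c * C * κ ^ δ)) * ((R / r) ^ (s + 1) * (r / R) ^ (s + 1)) *
            μ.real (Metric.closedBall x R) by ring, inv_mul_cancel₀ this, hinv]
        ring
    _ ≤ _ := by gcongr

theorem IsSelfSimilarMeasure.quasiDoubling_iff (hμ : F.IsSelfSimilarMeasure μ)
    (hsupp : μ.support = Icc (0 : ℝ) 1) : QuasiDoubling μ ↔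
      ∀ q : ℝ, 1 < q → ∀ A B : ℝ, 0 < A → A < B → ∃ c : ℝ, 0 < c ∧
        ∀ n : ℕ, ∀ x ∈ μ.support,
          μ.real (Metric.closedBall x (A * F.minRatio ^ n)) ≥
            c * (q ^ n)⁻¹ * μ.real (Metric.closedBall x (B * F.minRatio ^ n)) := by
  have := hμ.1
  have hl := F.minRatio_pos
  have hl1 := F.minRatio_lt_one
  constructor
  · intro h q hq A B hA hAB
    obtain ⟨ε, hε, hεq⟩ : ∃ ε > 0, F.minRatio ^ ε = q⁻¹ :=
      ⟨Real.logb F.minRatio q⁻¹, Real.logb_pos_of_base_lt_one hl hl1 (by positivity)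
        (inv_lt_one_of_one_lt₀ hq), Real.rpow_logb hl hl1.ne (by positivity)⟩
    obtain ⟨C, hC, hCr⟩ := h.exists_rpow_mul_le (hμ.powerLowerBound hsupp) (B / A) hε
    refine ⟨min 1 (C * A ^ ε), by positivity, fun n x hx => ?_⟩
    by_cases h1 : A * F.minRatio ^ n < 1
    · have h2 := hCr _ ⟨by positivity, h1⟩ x hx
      rw [show B / A * (A * F.minRatio ^ n) = B * F.minRatio ^ n by field_simp,
        Real.mul_rpow hA.le (by positivity), ← Real.rpow_pow_comm hl.le, hεq, inv_pow] at h2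
      refine le_trans ?_ h2
      rw [← mul_assoc]
      gcongr
      exact min_le_right _ _
    · have h3 : μ.real (Metric.closedBall x (A * F.minRatio ^ n)) = 1 := by
        refine le_antisymm measureReal_le_one ((measureReal_support (μ := μ)).symm.trans_le ?_)
        refine measureReal_mono fun y hy => ?_
        rw [hsupp] at hx hy
        rw [Metric.mem_closedBall, Real.dist_eq, abs_le]
        constructor <;> linarith [hx.1, hx.2, hy.1, hy.2]
      rw [h3, ge_iff_le]
      refine mul_le_one₀ (mul_le_one₀ (min_le_left _ _) (by positivity) ?_) measureReal_nonneg
        measureReal_le_one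
      exact inv_le_one_of_one_le₀ (one_le_pow₀ hq.le)
  · intro h ε hε
    -- For λ^(n+1) < r ≤ λ^n, the choice A = λ, B = 2 gives B(x, Aλ^n) ⊆ B(x, r) and B(x, 2r) ⊆ B(x,
    -- Bλ^n), while q^(-n) = (λ^n)^ε ≥ r^ε.
    obtain ⟨c, hc, hcn⟩ := h (F.minRatio ^ (-ε)) (Real.one_lt_rpow_of_pos_of_lt_one_of_neg hl hl1
      (by linarith)) F.minRatio 2 hl (by linarith)
    refine ⟨c, hc, fun r hr x hx => ?_⟩
    have hr0 := hr.1
    obtain ⟨n, hn1, hn2⟩ := exists_nat_pow_near_of_lt_one hr.1 hr.2.le hl hl1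
    have e : ((F.minRatio ^ (-ε)) ^ n)⁻¹ = (F.minRatio ^ n) ^ ε := by
      rw [← Real.rpow_natCast, ← Real.rpow_natCast, ← Real.rpow_mul hl.le, ← Real.rpow_mul hl.le,
        ← Real.rpow_neg hl.le]
      ring_nf
    have hmono := measureReal_closedBall_mono (μ := μ) (x := x)
      (mul_le_mul_of_nonneg_left hn2 zero_le_two)
    calc _ ≤ c * ((F.minRatio ^ (-ε)) ^ n)⁻¹ *
          μ.real (Metric.closedBall x (2 * F.minRatio ^ n)) := by
          rw [e]
          gcongr
      _ ≤ _ := hcn n x hx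
      _ ≤ _ := measureReal_mono (Metric.closedBall_subset_closedBall (by
          rw [← pow_succ']
          exact hn1.le))

end WeightedIFS

theorem corollary4p5 {m : ℕ} (F : WeightedIFS m) (μ : Measure ℝ)
    (hμ : F.IsSelfSimilarMeasure μ) (hsupp : μ.support = Icc (0 : ℝ) 1)
    (hwsc : F.WeakSeparation) :
    (quasiAssouadDim μ < ⊤ ↔
      ∀ q : ℝ, 1 < q → ∀ A B : ℝ, 0 < A → A < B → ∃ c : ℝ, 0 < c ∧
        ∀ n : ℕ, ∀ x ∈ μ.support,
          μ.real (Metric.closedBall x (A * F.minRatio ^ n)) ≥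
            c * (q ^ n)⁻¹ * μ.real (Metric.closedBall x (B * F.minRatio ^ n))) ∧
    (quasiAssouadDim μ < ⊤ ↔
      ∀ ε : ℝ, 0 < ε → ∃ C : ℝ, 0 < C ∧
        ∀ r ∈ Ioo (0 : ℝ) 1, ∀ x ∈ μ.support,
          μ.real (Metric.closedBall x r) ≥
            C * r ^ ε * μ.real (Metric.closedBall x (2 * r))) := by
  have := hμ.1
  have h : quasiAssouadDim μ < ⊤ ↔ QuasiDoubling μ :=
    ⟨QuasiDoubling.of_dim_lt_top (hμ.powerLowerBound hsupp), hμ.dim_lt_top hsupp hwsc⟩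
  exact ⟨h.trans (hμ.quasiDoubling_iff hsupp), h⟩
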